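/- **Theorem (Hardness of Sketching Square-Root Lasso).** There is a constant $c_0>0$, and for every constant $\varepsilon\in(0,1/2)$ there is a constant $\kappa>0$ depending only on $\varepsilon$, such that the following holds. Let $0<c\le c_0$, $0<\lambda<2\sqrt2/3$ and $n\ge 1$. There is a vector $b\in\mathbb{R}^n$, known to both players, such that for every $d\ge 0$: let Alice hold a matrix $M_1\in\mathbb{R}^{n\times d}$ and Bob a matrix $M_2\in\mathbb{R}^{n\times d}$, and let $$\mathrm{Opt}(M_1,M_2)=\min_{z\in\mathbb{R}^d}\ \|(M_1+M_2)z-b\|_2+\lambda\|z\|_1 .$$ Every public-coin randomized two-party protocol that, for all such $M_1,M_2$, outputs with probability at least $1-\varepsilon$ a value $v$ with $(1-c)\,\mathrm{Opt}(M_1,M_2)\le v\le(1+c)\,\mathrm{Opt}(M_1,M_2)$ exchanges at least $\kappa d$ bits in the worst case over inputs and coin flips; that is, determining a $(1+c)$-approximation to the optimal value requires $\Omega(d)$ bits of communication. This holds even if the protocol has to succeed, and its communication is counted, only on matrices $M_1,M_2$ with all entries in $\{0,1\}$, and even if only one of the players learns the output. -/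

import Mathlib

/-- A deterministic two-party communication protocol. Alice holds `x : X`, Bob holds `y : Y`.
At an inner node one player sends a bit computed from the player's own input (and from the bits sent
so far, which determine the node). At a leaf one player announces the output, computed from
that player's own input and from the transcript; a leaf with a constant output is a special case. -/
inductive CommProtocol (X Y V : Type) : Type
  | aliceOutput (out : X → V) : CommProtocol X Y V
  | bobOutput (out : Y → V) : CommProtocol X Y V
  | aliceSend (bit : X → Bool) (next : Bool → CommProtocol X Y V) : CommProtocol X Y V
  | bobSend (bit : Y → Bool) (next : Bool → CommProtocol X Y V) : CommProtocol X Y V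

namespace CommProtocol

variable {X Y V : Type}

/-- The output of the protocol on the input pair `(x, y)`. -/
def output : CommProtocol X Y V → X → Y → V
  | aliceOutput out, x, _ => out x
  | bobOutput out, _, y => out y
  | aliceSend bit next, x, y => output (next (bit x)) x y
  | bobSend bit next, x, y => output (next (bit y)) x y

/-- The number of bits that the players exchange on the input pair `(x, y)`. -/
def bits : CommProtocol X Y V → X → Y → ℕ
  | aliceOutput _, _, _ => 0
  | bobOutput _, _, _ => 0
  | aliceSend bit next, x, y => bits (next (bit x)) x y + 1
  | bobSend bit next, x, y => bits (next (bit y)) x y + 1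

end CommProtocol

/-- The square-root Lasso objective `‖M z - b‖₂ + lam * ‖z‖₁`. -/
noncomputable def sqrtLassoCost {n d : ℕ} (M : Matrix (Fin n) (Fin d) ℝ) (b : Fin n → ℝ)
    (lam : ℝ) (z : Fin d → ℝ) : ℝ :=
  ‖WithLp.toLp 2 (M.mulVec z - b)‖ + lam * ∑ j, |z j|

/-- The optimal value of the square-root Lasso problem. -/
noncomputable def sqrtLassoOpt {n d : ℕ} (M : Matrix (Fin n) (Fin d) ℝ) (b : Fin n → ℝ)
    (lam : ℝ) : ℝ :=
  ⨅ z : Fin d → ℝ, sqrtLassoCost M b lam z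

/-- For `lam > 0` the infimum is a minimum. -/
theorem sqrtLassoOpt_isLeast {n d : ℕ} (M : Matrix (Fin n) (Fin d) ℝ) (b : Fin n → ℝ)
    {lam : ℝ} (hlam : 0 < lam) :
    IsLeast (Set.range (sqrtLassoCost M b lam)) (sqrtLassoOpt M b lam) := by
  have hcont : Continuous (sqrtLassoCost M b lam) := by
    unfold sqrtLassoCost
    have h1 : Continuous fun z : Fin d → ℝ => WithLp.toLp 2 (M.mulVec z - b) :=
      (PiLp.continuous_toLp 2 _).comp
        ((Continuous.matrix_mulVec continuous_const continuous_id).sub continuous_const)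
    fun_prop
  have hle : ∀ z : Fin d → ℝ, lam * ‖z‖ ≤ sqrtLassoCost M b lam z := by
    intro z
    have h : ‖z‖ ≤ ∑ j, |z j| := by
      refine (pi_norm_le_iff_of_nonneg (Finset.sum_nonneg fun j _ => abs_nonneg _)).2 fun i => ?_
      exact Finset.single_le_sum (f := fun j => |z j|) (fun j _ => abs_nonneg _)
        (Finset.mem_univ i)
    have h2 := mul_le_mul_of_nonneg_left h hlam.le
    have h3 := norm_nonneg (WithLp.toLp 2 (M.mulVec z - b))
    unfold sqrtLassoCost
    linarith
  have htend : Filter.Tendsto (sqrtLassoCost M b lam) (Filter.cocompact _) Filter.atTop :=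
    Filter.tendsto_atTop_mono hle
      ((tendsto_norm_cocompact_atTop).const_mul_atTop hlam)
  obtain ⟨z, hz⟩ := hcont.exists_forall_le htend
  have hleast : IsLeast (Set.range (sqrtLassoCost M b lam)) (sqrtLassoCost M b lam z) :=
    ⟨⟨z, rfl⟩, by rintro _ ⟨w, rfl⟩; exact hz w⟩
  have heq : sqrtLassoOpt M b lam = sqrtLassoCost M b lam z := hleast.csInf_eq
  rw [heq]
  exact hleast

/-- All entries of the matrix are `0` or `1`. -/
def IsZeroOneMatrix {n d : ℕ} (M : Matrix (Fin n) (Fin d) ℝ) : Prop :=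
  ∀ i j, M i j = 0 ∨ M i j = 1

/-- `v` is a `1 + c` approximation to the value `opt`, that is `v = (1 ± c) opt`. -/
def IsApproxValue (c opt v : ℝ) : Prop :=
  (1 - c) * opt ≤ v ∧ v ≤ (1 + c) * opt

/-- The public-coin randomized protocol `π` (the coins `ω` have law `μ`, and given the coins the
players run the deterministic protocol `π ω`) determines, with error probability at most `ε` on each
input pair, a `1 + c` approximation to `min_z ‖(M₁ + M₂) z - b‖₂ + lam * ‖z‖₁`, where Alice holds
`M₁` and Bob holds `M₂`. It is required to succeed only on matrices with entries in `{0, 1}`.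
The vector `b` and the parameters are known to both players. -/
def ApproximatesSqrtLasso {Ω : Type} [MeasurableSpace Ω] (μ : MeasureTheory.Measure Ω) {n d : ℕ}
    (π : Ω → CommProtocol (Matrix (Fin n) (Fin d) ℝ) (Matrix (Fin n) (Fin d) ℝ) ℝ)
    (b : Fin n → ℝ) (lam c ε : ℝ) : Prop :=
  ∀ M₁ M₂ : Matrix (Fin n) (Fin d) ℝ, IsZeroOneMatrix M₁ → IsZeroOneMatrix M₂ →
    μ {ω | ¬ IsApproxValue c (sqrtLassoOpt (M₁ + M₂) b lam) ((π ω).output M₁ M₂)}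
      ≤ ENNReal.ofReal ε

/-!
The bound is a reduction from set disjointness. Alice's and Bob's sets become the first rows of
their matrices, all other rows vanish, and `b` is the first unit vector. The optimum is then `1`,
`lam` or `lam / 2` according to whether the largest entry of `M₁ + M₂` is `0`, `1` or `2`
(`le_sqrtLassoOpt_rowMatrix`, `sqrtLassoOpt_rowMatrix_le`), so that a `1 + c` approximation with
`c ≤ 1 / 50` tells these cases apart.

For disjointness the hard distribution is the classical one: choose a random set `D`, then a random
subset of `D` for Alice and a random subset of the complement of `D` for Bob. Intersecting inputs
arise by adding one random point `i` to both sets. Given `D` the inputs are independent, so on a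
rectangle the effect of pinning `i` is controlled by the degree-one Fourier coefficients of the two
indicator functions on subcubes. These are small for most `i` unless the function has exponentially
small mean (`sum_abs_corr_le`): for `f` with values in `[0, 1]` and a linear form `L` in random
signs, `f * (L - K) ≤ exp (L - K)` pointwise, and the exponential moment of `L` is sub-Gaussian.
Hence no rectangle of substantial mass on the disjoint pairs has noticeably less mass on the
intersecting ones (`disjointSum_sub_intersectingSum_le`). As the constant in front of the mass is
close to `1`, any error probability below `1 / 2` is covered without amplification.

A protocol of cost `C` cuts the inputs into at most `2 ^ C` rectangles
(`CommProtocol.accept_le_of_rectangle_le`), and averaging over the coins reduces the randomized case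
to the deterministic one (`exists_sum_error_le`). Coins need not give measurable error events, so
the average is taken over measurable hulls. For small `d` this is vacuous and the claim is that at
least one bit is sent. A protocol that sends nothing fails already on a single column, where the
optimum determines the sum of the players' bits (`exists_pos_bits`).
-/

open Finset

/-! ### Masked sums and degree-one Fourier coefficients -/

section Rectangle

variable {ι : Type*} [DecidableEq ι]

theorem inf_update_false (r D : ι → Bool) (i : ι) :
    r ⊓ Function.update D i false = Function.update (r ⊓ D) i false := by
  ext j
  by_cases hj : j = i
  · subst hj; simp
  · simp [hj]

theorem update_inf_update_true (r D : ι → Bool) (i : ι) (β : Bool) :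
    Function.update r i β ⊓ Function.update D i true = Function.update (r ⊓ D) i β := by
  ext j
  by_cases hj : j = i
  · subst hj; simp
  · simp [hj]

theorem compl_update (D : ι → Bool) (i : ι) (β : Bool) :
    (Function.update D i β)ᶜ = Function.update Dᶜ i (!β) := by
  ext j
  by_cases hj : j = i
  · subst hj; simp
  · simp [hj]

variable [Fintype ι]

/-- The sum of `f` over all points below `D`, each counted once for every `r` with `r ⊓ D` equal
to it: up to normalization, the mean of `f` at a uniformly random subset of `D`. -/
noncomputable def maskSum (f : (ι → Bool) → ℝ) (D : ι → Bool) : ℝ :=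
  ∑ r : ι → Bool, f (r ⊓ D)

/-- The same sum as `maskSum f D`, with the coordinate `i` of the argument fixed to `β`. -/
noncomputable def pinSum (f : (ι → Bool) → ℝ) (i : ι) (β : Bool) (D : ι → Bool) : ℝ :=
  ∑ r : ι → Bool, f (Function.update (r ⊓ D) i β)

/-- The unnormalized Fourier coefficient at `{i}` of `r ↦ f (r ⊓ D)`, where the character is `1` if
`r i` holds and `-1` otherwise. -/
noncomputable def corr (f : (ι → Bool) → ℝ) (i : ι) (D : ι → Bool) : ℝ :=
  ∑ r : ι → Bool, (if r i then 1 else -1) * f (r ⊓ D)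

theorem sum_update_eq_two_mul (i : ι) (h : (ι → Bool) → ℝ) :
    ∑ D, (h (Function.update D i true) + h (Function.update D i false)) = 2 * ∑ D, h D := by
  have hinv : Function.Involutive fun D : ι → Bool => Function.update D i (!D i) := by
    intro D
    simp
  have hflip : ∑ D : ι → Bool, h (Function.update D i (!D i)) = ∑ D, h D :=
    Equiv.sum_comp hinv.toPerm h
  rw [two_mul]
  nth_rewrite 1 [← hflip]
  rw [← sum_add_distrib]
  refine sum_congr rfl fun D _ => ?_
  cases hD : D i
  · have : Function.update D i false = D := by rw [← hD, Function.update_eq_self]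
    simp [this]
  · have : Function.update D i true = D := by rw [← hD, Function.update_eq_self]
    simp [this, add_comm]

theorem sum_update_le_two_mul (i : ι) (β : Bool) {h : (ι → Bool) → ℝ} (hh : ∀ D, 0 ≤ h D) :
    ∑ D, h (Function.update D i β) ≤ 2 * ∑ D, h D := by
  rw [← sum_update_eq_two_mul i h]
  refine sum_le_sum fun D _ => ?_
  have h1 := hh (Function.update D i true)
  have h2 := hh (Function.update D i false)
  cases β <;> linarith

theorem maskSum_update_false (f : (ι → Bool) → ℝ) (i : ι) (D : ι → Bool) :
    maskSum f (Function.update D i false) = pinSum f i false D := by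
  simp only [maskSum, pinSum, inf_update_false]

theorem maskSum_update_true (f : (ι → Bool) → ℝ) (i : ι) (D : ι → Bool) :
    2 * maskSum f (Function.update D i true) = pinSum f i true D + pinSum f i false D := by
  simp only [maskSum, pinSum]
  rw [← sum_update_eq_two_mul i, ← sum_add_distrib]
  simp only [update_inf_update_true]

theorem corr_update_true (f : (ι → Bool) → ℝ) (i : ι) (D : ι → Bool) :
    2 * corr f i (Function.update D i true) = pinSum f i true D - pinSum f i false D := by
  simp only [corr, pinSum]
  rw [← sum_update_eq_two_mul i, ← sum_sub_distrib]
  simp only [update_inf_update_true, Function.update_self]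
  refine sum_congr rfl fun r _ => ?_
  simp
  ring

theorem maskSum_nonneg {f : (ι → Bool) → ℝ} (hf : ∀ x, 0 ≤ f x) (D : ι → Bool) :
    0 ≤ maskSum f D :=
  sum_nonneg fun _ _ => hf _

theorem pinSum_nonneg {f : (ι → Bool) → ℝ} (hf : ∀ x, 0 ≤ f x) (i : ι) (β : Bool)
    (D : ι → Bool) : 0 ≤ pinSum f i β D :=
  sum_nonneg fun _ _ => hf _

theorem maskSum_le {f : (ι → Bool) → ℝ} (hf : ∀ x, f x ≤ 1) (D : ι → Bool) :
    maskSum f D ≤ 2 ^ Fintype.card ι := by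
  calc maskSum f D ≤ ∑ _r : ι → Bool, (1 : ℝ) := sum_le_sum fun _ _ => hf _
    _ = 2 ^ Fintype.card ι := by simp

/-- The moment generating function of a weighted sum of independent signs, each weight `±t`, is
sub-Gaussian. -/
theorem sum_exp_signs_le (t : ℝ) (s : ι → ℝ) (hs : ∀ i, s i = 1 ∨ s i = -1) :
    ∑ r : ι → Bool, Real.exp (∑ i, t * (s i * if r i then 1 else -1)) ≤
      2 ^ Fintype.card ι * Real.exp (Fintype.card ι * (t ^ 2 / 2)) := by
  have h1 : ∑ r : ι → Bool, Real.exp (∑ i, t * (s i * if r i then 1 else -1)) =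
      ∏ i, ∑ β : Bool, Real.exp (t * (s i * if β then 1 else -1)) := by
    rw [Finset.prod_univ_sum, Fintype.piFinset_univ]
    exact sum_congr rfl fun r _ => Real.exp_sum _ _
  rw [h1]
  calc ∏ i, ∑ β : Bool, Real.exp (t * (s i * if β then 1 else -1))
      ≤ ∏ _i : ι, (2 * Real.exp (t ^ 2 / 2)) := by
        refine prod_le_prod (fun i _ => sum_nonneg fun _ _ => (Real.exp_pos _).le) fun i _ => ?_
        have hc := Real.cosh_le_exp_half_sq t
        rw [Real.cosh_eq] at hc
        rcases hs i with h | h <;> simp [h] <;> linarith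
    _ = _ := by
        rw [prod_const, card_univ, mul_pow, ← Real.exp_nat_mul]

/-- A function with values in `[0, 1]` that is not exponentially small in mean is almost
uncorrelated with most coordinates. Tilting by the exponential of the linear form
`∑ i, ± r i` replaces the usual entropy argument. -/
theorem sum_abs_corr_le {f : (ι → Bool) → ℝ} (hf0 : ∀ x, 0 ≤ f x) (hf1 : ∀ x, f x ≤ 1)
    (D : ι → Bool) {t : ℝ} (ht : 0 < t) :
    ∑ i, |corr f i D| ≤ t * Fintype.card ι * maskSum f D +
      2 ^ Fintype.card ι * (t⁻¹ * Real.exp (-(Fintype.card ι * (t ^ 2 / 2)))) := by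
  set n : ℝ := (Fintype.card ι : ℝ)
  -- The signs turn the sum of absolute values into the correlation of `f` with one linear form.
  let s : ι → ℝ := fun i => if 0 ≤ corr f i D then 1 else -1
  have hs : ∀ i, s i = 1 ∨ s i = -1 := fun i => by
    by_cases h : 0 ≤ corr f i D <;> simp [s, h]
  have habs : ∀ i, |corr f i D| = s i * corr f i D := fun i => by
    by_cases h : 0 ≤ corr f i D
    · simp [s, h, abs_of_nonneg]
    · simp [s, h, abs_of_neg (not_le.1 h)]
  let L : (ι → Bool) → ℝ := fun r => ∑ i, t * (s i * if r i then 1 else -1)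
  have hL : t * ∑ i, |corr f i D| = ∑ r, f (r ⊓ D) * L r := by
    rw [sum_congr rfl fun i _ => habs i]
    simp only [corr, L, mul_sum]
    rw [sum_comm]
    refine sum_congr rfl fun r _ => sum_congr rfl fun i _ => ?_
    ring
  have hpt : ∀ r, f (r ⊓ D) * L r ≤
      n * t ^ 2 * f (r ⊓ D) + Real.exp (-(n * t ^ 2)) * Real.exp (L r) := fun r => by
    have h0 := hf0 (r ⊓ D)
    have h1 := hf1 (r ⊓ D)
    have he := Real.add_one_le_exp (L r - n * t ^ 2)
    have hp := Real.exp_pos (L r - n * t ^ 2)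
    have key : f (r ⊓ D) * (L r - n * t ^ 2) ≤ Real.exp (L r - n * t ^ 2) := by
      rcases le_total 0 (L r - n * t ^ 2) with hy | hy
      · linarith [mul_le_mul_of_nonneg_right h1 hy]
      · linarith [mul_nonpos_of_nonneg_of_nonpos h0 hy]
    rw [← Real.exp_add, neg_add_eq_sub]
    linarith
  have hsum : t * ∑ i, |corr f i D| ≤ n * t ^ 2 * maskSum f D +
      2 ^ Fintype.card ι * Real.exp (-(n * (t ^ 2 / 2))) := by
    rw [hL]
    refine (sum_le_sum fun r _ => hpt r).trans ?_
    rw [sum_add_distrib, ← mul_sum, ← mul_sum]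
    refine add_le_add le_rfl ?_
    calc _ ≤ Real.exp (-(n * t ^ 2)) * (2 ^ Fintype.card ι * Real.exp (n * (t ^ 2 / 2))) :=
          mul_le_mul_of_nonneg_left (sum_exp_signs_le t s hs) (Real.exp_pos _).le
      _ = 2 ^ Fintype.card ι * (Real.exp (-(n * t ^ 2)) * Real.exp (n * (t ^ 2 / 2))) := by ring
      _ = _ := by rw [← Real.exp_add]; congr 2; ring
  calc ∑ i, |corr f i D| = t⁻¹ * (t * ∑ i, |corr f i D|) := by field_simp
    _ ≤ t⁻¹ * _ := mul_le_mul_of_nonneg_left hsum (inv_pos.2 ht).le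
    _ = _ := by field_simp

/-! ### The rectangle bound for the hard distribution -/

/-- The unnormalized mean of `h` over the hard disjoint pairs: `D` is a uniformly random set, the
first set is a uniformly random subset of `D` and the second one of its complement. There are
`8 ^ Fintype.card ι` summands. -/
noncomputable def disjointSum (h : (ι → Bool) × (ι → Bool) → ℝ) : ℝ :=
  ∑ D : ι → Bool, ∑ r : ι → Bool, ∑ s : ι → Bool, h (r ⊓ D, s ⊓ Dᶜ)

/-- The unnormalized mean of `h` over the hard pairs that meet in exactly one point: a hard
disjoint pair with a uniformly random coordinate put into both sets. -/
noncomputable def intersectingSum (h : (ι → Bool) × (ι → Bool) → ℝ) : ℝ :=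
  ∑ i : ι, ∑ D : ι → Bool, ∑ r : ι → Bool, ∑ s : ι → Bool,
    h (Function.update (r ⊓ D) i true, Function.update (s ⊓ Dᶜ) i true)

theorem disjointSum_mul (f g : (ι → Bool) → ℝ) :
    disjointSum (fun p => f p.1 * g p.2) = ∑ D, maskSum f D * maskSum g Dᶜ := by
  simp only [disjointSum, maskSum, sum_mul_sum]

theorem intersectingSum_mul (f g : (ι → Bool) → ℝ) :
    intersectingSum (fun p => f p.1 * g p.2) = ∑ i, ∑ D, pinSum f i true D * pinSum g i true Dᶜ := by
  simp only [intersectingSum, pinSum, sum_mul_sum]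

/-- Summing over whether `i ∈ D` turns `disjointSum` into a combination of the three disjoint
patterns at the coordinate `i`. -/
theorem four_mul_disjointSum_mul (f g : (ι → Bool) → ℝ) (i : ι) :
    4 * disjointSum (fun p => f p.1 * g p.2) =
      ∑ D, ((pinSum f i true D + pinSum f i false D) * pinSum g i false Dᶜ +
        pinSum f i false D * (pinSum g i true Dᶜ + pinSum g i false Dᶜ)) := by
  rw [disjointSum_mul, show (4 : ℝ) = 2 * 2 by norm_num, mul_assoc,
    ← sum_update_eq_two_mul i, mul_sum]
  refine sum_congr rfl fun D _ => ?_
  rw [← maskSum_update_true f i D, ← maskSum_update_true g i Dᶜ, ← maskSum_update_false,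
    ← maskSum_update_false, compl_update, compl_update]
  simp only [Bool.not_true, Bool.not_false]
  ring

/-- Given `D`, the two sets are independent, so the weight of the intersecting pattern at a
coordinate is a product, and it is close to that of the disjoint patterns unless pinning the
coordinate changes one of the factors much. -/
theorem mul_ge_of_pinned {F₀ F₁ G₀ G₁ : ℝ} (hF₀ : 0 ≤ F₀) (hF₁ : 0 ≤ F₁) (hG₀ : 0 ≤ G₀)
    (hG₁ : 0 ≤ G₁) :
    ((F₁ + F₀) * G₀ + F₀ * (G₁ + G₀)) / 4 - 2 * (|F₁ - F₀| * G₀ + |G₁ - G₀| * F₀) ≤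
      F₁ * G₁ := by
  have a1 := mul_le_mul_of_nonneg_right (neg_abs_le (F₁ - F₀)) hG₀
  have a2 := mul_le_mul_of_nonneg_right (le_abs_self (F₁ - F₀)) hG₀
  have b1 := mul_le_mul_of_nonneg_right (neg_abs_le (G₁ - G₀)) hF₀
  have b2 := mul_le_mul_of_nonneg_right (le_abs_self (G₁ - G₀)) hF₀
  rcases le_total F₀ F₁ with h | h
  · nlinarith [mul_nonneg (sub_nonneg.2 h) hG₁]
  · rcases le_total G₀ G₁ with h' | h'
    · nlinarith [mul_nonneg hF₁ (sub_nonneg.2 h')]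
    · nlinarith [mul_nonneg (sub_nonneg.2 h) (sub_nonneg.2 h')]

/-- The total change of the first factor by pinning, weighted by the second factor. Pinning `i` to
`true` or `false` changes the masked sum by twice the Fourier coefficient at `i`, provided `i ∈ D`;
restricting to such `D` costs another factor of two. -/
theorem sum_abs_pinSum_sub_le {f g : (ι → Bool) → ℝ} (hf0 : ∀ x, 0 ≤ f x) (hf1 : ∀ x, f x ≤ 1)
    (hg0 : ∀ x, 0 ≤ g x) (hg1 : ∀ x, g x ≤ 1) {t : ℝ} (ht : 0 < t) :
    ∑ i, ∑ D, |pinSum f i true D - pinSum f i false D| * pinSum g i false Dᶜ ≤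
      4 * (t * Fintype.card ι * disjointSum (fun p => f p.1 * g p.2) +
        8 ^ Fintype.card ι * (t⁻¹ * Real.exp (-(Fintype.card ι * (t ^ 2 / 2))))) := by
  set B := t⁻¹ * Real.exp (-(Fintype.card ι * (t ^ 2 / 2)))
  have hB : 0 ≤ B := by positivity
  calc ∑ i, ∑ D, |pinSum f i true D - pinSum f i false D| * pinSum g i false Dᶜ
      = ∑ i, 2 * ∑ D, |corr f i (Function.update D i true)| *
          maskSum g (Function.update D i true)ᶜ := by
        refine sum_congr rfl fun i _ => ?_
        rw [mul_sum]
        refine sum_congr rfl fun D _ => ?_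
        rw [← corr_update_true, compl_update, Bool.not_true, maskSum_update_false, abs_mul,
          abs_two, mul_assoc]
    _ ≤ ∑ i, 2 * (2 * ∑ D, |corr f i D| * maskSum g Dᶜ) := by
        refine sum_le_sum fun i _ => mul_le_mul_of_nonneg_left ?_ zero_le_two
        exact sum_update_le_two_mul i true (h := fun D => |corr f i D| * maskSum g Dᶜ)
          fun D => mul_nonneg (abs_nonneg _) (maskSum_nonneg hg0 _)
    _ = 4 * ∑ D, (∑ i, |corr f i D|) * maskSum g Dᶜ := by
        simp only [sum_mul, mul_sum]
        rw [sum_comm]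
        refine sum_congr rfl fun D _ => sum_congr rfl fun i _ => ?_
        ring
    _ ≤ 4 * ∑ D, (t * Fintype.card ι * (maskSum f D * maskSum g Dᶜ) +
          2 ^ Fintype.card ι * B * 2 ^ Fintype.card ι) := by
        refine mul_le_mul_of_nonneg_left (sum_le_sum fun D _ => ?_) (by norm_num)
        have h1 := mul_le_mul_of_nonneg_right (sum_abs_corr_le hf0 hf1 D ht)
          (maskSum_nonneg hg0 Dᶜ)
        have h2 := mul_le_mul_of_nonneg_left (maskSum_le hg1 Dᶜ)
          (show 0 ≤ 2 ^ Fintype.card ι * B by positivity)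
        linarith
    _ = _ := by
        rw [sum_add_distrib, ← mul_sum, ← disjointSum_mul, sum_const, card_univ, Fintype.card_fun,
          Fintype.card_bool, nsmul_eq_mul, show (8 : ℝ) = 2 * 2 * 2 by norm_num, mul_pow, mul_pow]
        push_cast
        ring

theorem disjointSum_swap_compl (f g : (ι → Bool) → ℝ) :
    disjointSum (fun p => g p.1 * f p.2) = disjointSum (fun p => f p.1 * g p.2) := by
  rw [disjointSum_mul, disjointSum_mul]
  rw [← Equiv.sum_comp (compl_involutive (α := ι → Bool)).toPerm]
  refine sum_congr rfl fun D _ => ?_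
  simp [mul_comm]

/-- A one-sided bound for rectangles: up to an exponentially small error, a combinatorial rectangle
has at least nearly as much mass on the hard intersecting pairs as on the hard disjoint pairs. -/
theorem disjointSum_sub_intersectingSum_le {f g : (ι → Bool) → ℝ} (hf0 : ∀ x, 0 ≤ f x)
    (hf1 : ∀ x, f x ≤ 1) (hg0 : ∀ x, 0 ≤ g x) (hg1 : ∀ x, g x ≤ 1) {t : ℝ} (ht : 0 < t) :
    (1 - 16 * t) * Fintype.card ι * disjointSum (fun p => f p.1 * g p.2) -
        intersectingSum (fun p => f p.1 * g p.2) ≤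
      16 * (8 ^ Fintype.card ι * (t⁻¹ * Real.exp (-(Fintype.card ι * (t ^ 2 / 2))))) := by
  have hu := sum_abs_pinSum_sub_le hf0 hf1 hg0 hg1 ht
  have hv : ∑ i, ∑ D, |pinSum g i true Dᶜ - pinSum g i false Dᶜ| * pinSum f i false D ≤
      4 * (t * Fintype.card ι * disjointSum (fun p => g p.1 * f p.2) +
        8 ^ Fintype.card ι * (t⁻¹ * Real.exp (-(Fintype.card ι * (t ^ 2 / 2))))) := by
    refine le_trans (le_of_eq ?_) (sum_abs_pinSum_sub_le hg0 hg1 hf0 hf1 ht)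
    refine sum_congr rfl fun i _ => ?_
    rw [← Equiv.sum_comp (compl_involutive (α := ι → Bool)).toPerm]
    simp
  rw [disjointSum_swap_compl] at hv
  have hmain : ∑ i : ι, (disjointSum (fun p => f p.1 * g p.2) -
      2 * (∑ D, |pinSum f i true D - pinSum f i false D| * pinSum g i false Dᶜ +
        ∑ D, |pinSum g i true Dᶜ - pinSum g i false Dᶜ| * pinSum f i false D)) ≤
      intersectingSum (fun p => f p.1 * g p.2) := by
    rw [intersectingSum_mul]
    refine sum_le_sum fun i _ => ?_
    have h4 := four_mul_disjointSum_mul f g i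
    have h := sum_le_sum fun (D : ι → Bool) (_ : D ∈ univ) =>
      mul_ge_of_pinned (pinSum_nonneg hf0 i false D) (pinSum_nonneg hf0 i true D)
        (pinSum_nonneg hg0 i false Dᶜ) (pinSum_nonneg hg0 i true Dᶜ)
    rw [sum_sub_distrib, ← sum_div, ← h4, ← mul_sum, sum_add_distrib] at h
    linarith
  rw [sum_sub_distrib, ← mul_sum, sum_add_distrib, sum_const, card_univ, nsmul_eq_mul] at hmain
  linarith

end Rectangle

/-! ### From rectangles to randomized protocols -/

namespace CommProtocol

/-- A bound that an additive functional satisfies on all rectangles holds, up to the factor `2 ^ C`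
bounding the number of transcripts, on the set of inputs on which a protocol accepts. Only the cost
on the rectangle `A ×ˢ B` of admissible inputs matters. -/
theorem accept_le_of_rectangle_le {X Y V : Type} (Λ : (X × Y → ℝ) →+ ℝ) {K : ℝ} (hK : 0 ≤ K)
    (hΛ : ∀ (A : Set X) (B : Set Y), Λ ((A ×ˢ B).indicator 1) ≤ K) (S : Set V)
    (P : CommProtocol X Y V) (A : Set X) (B : Set Y) (C : ℕ)
    (hC : ∀ x ∈ A, ∀ y ∈ B, P.bits x y ≤ C) :
    Λ ({p | p ∈ A ×ˢ B ∧ P.output p.1 p.2 ∈ S}.indicator 1) ≤ 2 ^ C * K := by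
  have hpow : ∀ C : ℕ, K ≤ 2 ^ C * K := fun C =>
    le_mul_of_one_le_left hK (one_le_pow₀ one_le_two)
  induction P generalizing A B C with
  | aliceOutput out =>
    refine le_trans (le_of_eq ?_) ((hΛ (A ∩ out ⁻¹' S) B).trans (hpow C))
    congr 2
    ext ⟨x, y⟩
    simp only [output, Set.mem_prod, Set.mem_ofPred_eq, Set.mem_inter_iff, Set.mem_preimage]
    tauto
  | bobOutput out =>
    refine le_trans (le_of_eq ?_) ((hΛ A (B ∩ out ⁻¹' S)).trans (hpow C))
    congr 2
    ext ⟨x, y⟩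
    simp only [output, Set.mem_prod, Set.mem_ofPred_eq, Set.mem_inter_iff, Set.mem_preimage]
    tauto
  | aliceSend bit next ih =>
    rcases C with _ | C
    · have hempty : {p : X × Y | p ∈ A ×ˢ B ∧ (aliceSend bit next).output p.1 p.2 ∈ S} = ∅ := by
        ext ⟨x, y⟩
        simp only [Set.mem_ofPred_eq, Set.mem_prod, Set.mem_empty_iff_false, iff_false]
        rintro ⟨⟨hx, hy⟩, -⟩
        simpa [bits] using hC x hx y hy
      rw [hempty, Set.indicator_empty', map_zero]
      positivity
    · have hsub : ∀ β, Λ ({p | p ∈ (A ∩ bit ⁻¹' {β}) ×ˢ B ∧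
          (next β).output p.1 p.2 ∈ S}.indicator 1) ≤ 2 ^ C * K := fun β => by
        refine ih β _ _ C ?_
        rintro x ⟨hx, rfl⟩ y hy
        simpa [bits] using hC x hx y hy
      have hunion : {p : X × Y | p ∈ A ×ˢ B ∧ (aliceSend bit next).output p.1 p.2 ∈ S} =
          {p | p ∈ (A ∩ bit ⁻¹' {true}) ×ˢ B ∧ (next true).output p.1 p.2 ∈ S} ∪
          {p | p ∈ (A ∩ bit ⁻¹' {false}) ×ˢ B ∧ (next false).output p.1 p.2 ∈ S} := by
        ext ⟨x, y⟩
        cases h : bit x <;> simp [output, h]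
      rw [hunion, Set.indicator_union_of_disjoint]
      · have := hsub true
        have := hsub false
        change Λ (_ + _) ≤ _
        rw [map_add, pow_succ]
        linarith
      · rw [Set.disjoint_left]
        rintro ⟨x, y⟩ ⟨⟨⟨-, h1⟩, -⟩, -⟩ ⟨⟨⟨-, h2⟩, -⟩, -⟩
        simp_all
  | bobSend bit next ih =>
    rcases C with _ | C
    · have hempty : {p : X × Y | p ∈ A ×ˢ B ∧ (bobSend bit next).output p.1 p.2 ∈ S} = ∅ := by
        ext ⟨x, y⟩
        simp only [Set.mem_ofPred_eq, Set.mem_prod, Set.mem_empty_iff_false, iff_false]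
        rintro ⟨⟨hx, hy⟩, -⟩
        simpa [bits] using hC x hx y hy
      rw [hempty, Set.indicator_empty', map_zero]
      positivity
    · have hsub : ∀ β, Λ ({p | p ∈ A ×ˢ (B ∩ bit ⁻¹' {β}) ∧
          (next β).output p.1 p.2 ∈ S}.indicator 1) ≤ 2 ^ C * K := fun β => by
        refine ih β _ _ C ?_
        rintro x hx y ⟨hy, rfl⟩
        simpa [bits] using hC x hx y hy
      have hunion : {p : X × Y | p ∈ A ×ˢ B ∧ (bobSend bit next).output p.1 p.2 ∈ S} =
          {p | p ∈ A ×ˢ (B ∩ bit ⁻¹' {true}) ∧ (next true).output p.1 p.2 ∈ S} ∪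
          {p | p ∈ A ×ˢ (B ∩ bit ⁻¹' {false}) ∧ (next false).output p.1 p.2 ∈ S} := by
        ext ⟨x, y⟩
        cases h : bit y <;> simp [output, h]
      rw [hunion, Set.indicator_union_of_disjoint]
      · have := hsub true
        have := hsub false
        change Λ (_ + _) ≤ _
        rw [map_add, pow_succ]
        linarith
      · rw [Set.disjoint_left]
        rintro ⟨x, y⟩ ⟨⟨-, -, h1⟩, -⟩ ⟨⟨-, -, h2⟩, -⟩
        simp_all

end CommProtocol

/-- If each of finitely many events has outer measure at most `ε`, some point lies in at most an
`ε` fraction of them. The events need not be measurable. -/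
theorem exists_sum_indicator_le {Ω : Type*} [MeasurableSpace Ω] (μ : MeasureTheory.Measure Ω)
    [MeasureTheory.IsProbabilityMeasure μ] {J : Type*} [Fintype J] (bad : J → Set Ω) {ε : ℝ}
    (hε : 0 ≤ ε) (hbad : ∀ j, μ (bad j) ≤ ENNReal.ofReal ε) :
    ∃ ω, ∑ j, (bad j).indicator (fun _ => (1 : ℝ)) ω ≤ ε * Fintype.card J := by
  -- Measurable hulls have the same measure, and can be integrated.
  let H : J → Set Ω := fun j => MeasureTheory.toMeasurable μ (bad j)
  have hH : ∀ j, MeasurableSet (H j) := fun j => MeasureTheory.measurableSet_toMeasurable _ _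
  have hint : ∀ j, MeasureTheory.Integrable ((H j).indicator fun _ => (1 : ℝ)) μ := fun j =>
    (MeasureTheory.integrable_const 1).indicator (hH j)
  obtain ⟨ω, hω⟩ := MeasureTheory.exists_le_integral
    (MeasureTheory.integrable_finsetSum univ fun j _ => hint j)
  refine ⟨ω, ?_⟩
  calc ∑ j, (bad j).indicator (fun _ => (1 : ℝ)) ω
      ≤ ∑ j, (H j).indicator (fun _ => (1 : ℝ)) ω :=
        sum_le_sum fun j _ => Set.indicator_le_indicator_of_subset
          (MeasureTheory.subset_toMeasurable μ (bad j)) (fun _ => zero_le_one) ω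
    _ ≤ ∫ a, ∑ j, (H j).indicator (fun _ => (1 : ℝ)) a ∂μ := hω
    _ = ∑ j, μ.real (H j) := by
        rw [MeasureTheory.integral_finsetSum _ fun j _ => hint j]
        refine sum_congr rfl fun j _ => ?_
        rw [MeasureTheory.integral_indicator_const _ (hH j), smul_eq_mul, mul_one]
    _ ≤ ∑ _j : J, ε := by
        refine sum_le_sum fun j _ => ?_
        refine ENNReal.toReal_le_of_le_ofReal hε ?_
        rw [MeasureTheory.measure_toMeasurable]
        exact hbad j
    _ = ε * Fintype.card J := by simp [mul_comm]

/-- The additive functional that is bounded on rectangles: `1 - 16 * t` times the mass on the hard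
disjoint pairs minus the mass on the hard intersecting pairs, both scaled by
`Fintype.card ι * 8 ^ Fintype.card ι`. The maps `φ` and `ψ` encode sets as the players' inputs. -/
noncomputable def massGap {ι : Type*} [DecidableEq ι] [Fintype ι] {X Y : Type}
    (φ : (ι → Bool) → X) (ψ : (ι → Bool) → Y) (t : ℝ) : (X × Y → ℝ) →+ ℝ :=
  AddMonoidHom.mk'
    (fun h => (1 - 16 * t) * Fintype.card ι * disjointSum (fun p => h (φ p.1, ψ p.2)) -
      intersectingSum fun p => h (φ p.1, ψ p.2))
    fun h₁ h₂ => by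
      simp only [disjointSum, intersectingSum, Pi.add_apply, sum_add_distrib]
      ring

/-- A deterministic protocol of cost at most `C` that errs, on average over the hard pairs, with
probability at most `ε < 1 / 2`, has `2 ^ C` exponentially large. The set `S` consists of the outputs
that are read as disjoint. -/
theorem CommProtocol.lower_bound_of_sum_error_le {ι : Type*} [DecidableEq ι] [Fintype ι]
    {X Y V : Type} (φ : (ι → Bool) → X) (ψ : (ι → Bool) → Y) (P : CommProtocol X Y V) (S : Set V)
    {A : Set X} {B : Set Y} (hφ : ∀ x, φ x ∈ A) (hψ : ∀ y, ψ y ∈ B) {C : ℕ}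
    (hC : ∀ x ∈ A, ∀ y ∈ B, P.bits x y ≤ C) {t ε : ℝ} (ht : 0 < t) (hε : 1 - 2 * ε = 32 * t)
    (herr : Fintype.card ι * disjointSum
          (fun p => {v | v ∉ S}.indicator (1 : V → ℝ) (P.output (φ p.1) (ψ p.2))) +
        intersectingSum (fun p => S.indicator (1 : V → ℝ) (P.output (φ p.1) (ψ p.2))) ≤
      2 * ε * (Fintype.card ι * 8 ^ Fintype.card ι)) :
    Fintype.card ι * t ^ 2 * Real.exp (Fintype.card ι * (t ^ 2 / 2)) ≤ 2 ^ C := by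
  set n := Fintype.card ι
  set acc : X × Y → ℝ := {p | p ∈ A ×ˢ B ∧ P.output p.1 p.2 ∈ S}.indicator 1
  have hacc : ∀ x y, acc (φ x, ψ y) = S.indicator (1 : V → ℝ) (P.output (φ x) (ψ y)) := by
    intro x y
    by_cases h : P.output (φ x) (ψ y) ∈ S <;> simp [acc, Set.indicator, h, hφ, hψ]
  -- The functional `massGap` at the set of inputs whose output is read as disjoint.
  have hgap := P.accept_le_of_rectangle_le (massGap φ ψ t)
    (K := 16 * (8 ^ n * (t⁻¹ * Real.exp (-(n * (t ^ 2 / 2)))))) (by positivity) (by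
      intro A' B'
      have h01 : ∀ {Z : Type} (D : Set Z) (z : Z),
          0 ≤ D.indicator (1 : Z → ℝ) z ∧ D.indicator (1 : Z → ℝ) z ≤ 1 := fun D z => by
        by_cases h : z ∈ D <;> simp [h]
      have h := disjointSum_sub_intersectingSum_le (ι := ι)
        (f := fun x => A'.indicator 1 (φ x)) (g := fun y => B'.indicator 1 (ψ y))
        (fun x => (h01 A' (φ x)).1) (fun x => (h01 A' (φ x)).2)
        (fun y => (h01 B' (ψ y)).1) (fun y => (h01 B' (ψ y)).2) ht
      have hprod : ∀ x y, (A' ×ˢ B').indicator (1 : X × Y → ℝ) (φ x, ψ y) =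
          A'.indicator 1 (φ x) * B'.indicator 1 (ψ y) := fun x y => by
        by_cases hx : φ x ∈ A' <;> by_cases hy : ψ y ∈ B' <;> simp [Set.indicator, hx, hy]
      simpa only [massGap, AddMonoidHom.mk'_apply, hprod] using h) S A B C hC
  change (1 - 16 * t) * n * disjointSum (fun p => acc (φ p.1, ψ p.2)) -
    intersectingSum (fun p => acc (φ p.1, ψ p.2)) ≤ _ at hgap
  simp only [hacc] at hgap
  set W := disjointSum fun p : (ι → Bool) × (ι → Bool) =>
    S.indicator (1 : V → ℝ) (P.output (φ p.1) (ψ p.2))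
  have hWadd : disjointSum (fun p : (ι → Bool) × (ι → Bool) =>
      {v | v ∉ S}.indicator (1 : V → ℝ) (P.output (φ p.1) (ψ p.2))) + W = 8 ^ n := by
    have h1 : ∀ v, {v | v ∉ S}.indicator (1 : V → ℝ) v + S.indicator 1 v = 1 := fun v => by
      by_cases h : v ∈ S <;> simp [Set.indicator, h]
    simp only [W, disjointSum, ← sum_add_distrib, h1]
    simp only [sum_const, card_univ, Fintype.card_fun, Fintype.card_bool, nsmul_eq_mul, mul_one]
    rw [show (8 : ℝ) = 2 * (2 * 2) by norm_num, mul_pow, mul_pow]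
    push_cast
    rfl
  have hWnonneg : 0 ≤ disjointSum (fun p : (ι → Bool) × (ι → Bool) =>
      {v | v ∉ S}.indicator (1 : V → ℝ) (P.output (φ p.1) (ψ p.2))) :=
    sum_nonneg fun _ _ => sum_nonneg fun _ _ => sum_nonneg fun _ _ =>
      Set.indicator_nonneg (fun _ _ => zero_le_one) _
  have hW : W ≤ 8 ^ n := by linarith
  have hn : (0 : ℝ) ≤ n := Nat.cast_nonneg _
  have hWn : t * n * W ≤ t * n * 8 ^ n := mul_le_mul_of_nonneg_left hW (by positivity)
  have h8 : (0 : ℝ) < 8 ^ n := by positivity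
  have hmain : (8 : ℝ) ^ n * (16 * (t * n)) ≤
      8 ^ n * (16 * (2 ^ C * (t⁻¹ * Real.exp (-(n * (t ^ 2 / 2)))))) := by
    have e1 : disjointSum (fun p : (ι → Bool) × (ι → Bool) =>
      {v | v ∉ S}.indicator (1 : V → ℝ) (P.output (φ p.1) (ψ p.2))) = 8 ^ n - W := by linarith
    rw [e1, show 2 * ε = 1 - 32 * t by linarith] at herr
    linarith
  have hfin := le_of_mul_le_mul_left (le_of_mul_le_mul_left hmain h8) (by norm_num : (0 : ℝ) < 16)
  calc n * t ^ 2 * Real.exp (n * (t ^ 2 / 2))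
      = t * n * (t * Real.exp (n * (t ^ 2 / 2))) := by ring
    _ ≤ 2 ^ C * (t⁻¹ * Real.exp (-(n * (t ^ 2 / 2)))) * (t * Real.exp (n * (t ^ 2 / 2))) :=
        mul_le_mul_of_nonneg_right hfin (by positivity)
    _ = 2 ^ C := by
        rw [Real.exp_neg]
        field_simp

/-- The averaging step: a public-coin protocol that errs with probability at most `ε` on each hard
pair contains a deterministic protocol that errs on at most an `ε` fraction of them. -/
theorem exists_sum_error_le {ι : Type*} [DecidableEq ι] [Fintype ι] {X Y V Ω : Type}
    [MeasurableSpace Ω] (μ : MeasureTheory.Measure Ω) [MeasureTheory.IsProbabilityMeasure μ]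
    (φ : (ι → Bool) → X) (ψ : (ι → Bool) → Y) (π : Ω → CommProtocol X Y V) (S : Set V) {ε : ℝ}
    (hε : 0 ≤ ε)
    (hdisj : ∀ x y : ι → Bool, (∀ j, ¬ (x j ∧ y j)) →
      μ {ω | (π ω).output (φ x) (ψ y) ∉ S} ≤ ENNReal.ofReal ε)
    (hinter : ∀ x y : ι → Bool, (∃ j, x j ∧ y j) →
      μ {ω | (π ω).output (φ x) (ψ y) ∈ S} ≤ ENNReal.ofReal ε) :
    ∃ ω, Fintype.card ι * disjointSum
          (fun p => {v | v ∉ S}.indicator (1 : V → ℝ) ((π ω).output (φ p.1) (ψ p.2))) +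
        intersectingSum (fun p => S.indicator (1 : V → ℝ) ((π ω).output (φ p.1) (ψ p.2))) ≤
      2 * ε * (Fintype.card ι * 8 ^ Fintype.card ι) := by
  let J := ι × (ι → Bool) × (ι → Bool) × (ι → Bool)
  let bad : J ⊕ J → Set Ω := Sum.elim
    (fun q => {ω | (π ω).output (φ (q.2.2.1 ⊓ q.2.1)) (ψ (q.2.2.2 ⊓ q.2.1ᶜ)) ∉ S})
    (fun q => {ω | (π ω).output (φ (Function.update (q.2.2.1 ⊓ q.2.1) q.1 true))
      (ψ (Function.update (q.2.2.2 ⊓ q.2.1ᶜ) q.1 true)) ∈ S})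
  obtain ⟨ω, hω⟩ := exists_sum_indicator_le μ bad hε (by
    rintro (⟨i, D, r, s⟩ | ⟨i, D, r, s⟩)
    · refine hdisj _ _ fun j => ?_
      cases h : D j <;> simp [h]
    · exact hinter _ _ ⟨i, by simp⟩)
  refine ⟨ω, le_trans (le_of_eq ?_) (hω.trans (le_of_eq ?_))⟩
  · rw [Fintype.sum_sum_type]
    simp only [J, Fintype.sum_prod_type, disjointSum, intersectingSum]
    rw [← nsmul_eq_mul, ← card_univ, ← sum_const]
    rfl
  · simp only [J, Fintype.card_sum, Fintype.card_prod, Fintype.card_fun, Fintype.card_bool]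
    rw [show (8 : ℝ) = 2 * (2 * 2) by norm_num, mul_pow, mul_pow]
    push_cast
    ring

/-- The randomized communication complexity of set disjointness is linear: a protocol that decides
whether the encoded sets meet, by whether its output lies in `S`, exceeds the cost `C` for some
coins and inputs unless `2 ^ C` is exponentially large in the size of the ground set. -/
theorem exists_lt_bits_of_disjointness {ι : Type*} [DecidableEq ι] [Fintype ι] {X Y V Ω : Type}
    [MeasurableSpace Ω] (μ : MeasureTheory.Measure Ω) [MeasureTheory.IsProbabilityMeasure μ]
    (φ : (ι → Bool) → X) (ψ : (ι → Bool) → Y) (π : Ω → CommProtocol X Y V) (S : Set V) {t ε : ℝ}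
    (hε : 0 ≤ ε) (ht : 0 < t) (htε : 1 - 2 * ε = 32 * t)
    (hdisj : ∀ x y : ι → Bool, (∀ j, ¬ (x j ∧ y j)) →
      μ {ω | (π ω).output (φ x) (ψ y) ∉ S} ≤ ENNReal.ofReal ε)
    (hinter : ∀ x y : ι → Bool, (∃ j, x j ∧ y j) →
      μ {ω | (π ω).output (φ x) (ψ y) ∈ S} ≤ ENNReal.ofReal ε) {C : ℕ}
    (hC : (2 : ℝ) ^ C < Fintype.card ι * t ^ 2 * Real.exp (Fintype.card ι * (t ^ 2 / 2))) :
    ∃ ω x y, C < (π ω).bits (φ x) (ψ y) := by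
  obtain ⟨ω, hω⟩ := exists_sum_error_le μ φ ψ π S hε hdisj hinter
  by_contra! hbits
  refine hC.not_ge ((π ω).lower_bound_of_sum_error_le φ ψ S (A := Set.range φ) (B := Set.range ψ)
    (fun x => ⟨x, rfl⟩) (fun y => ⟨y, rfl⟩) ?_ ht htε hω)
  rintro _ ⟨x, rfl⟩ _ ⟨y, rfl⟩
  exact hbits ω x y

/-- A protocol that sends nothing cannot compute a function of two bits that changes whenever one of
them is flipped: whoever announces the output errs on two of the four inputs. -/
theorem exists_pos_bits {X Y V Ω : Type} [MeasurableSpace Ω] (μ : MeasureTheory.Measure Ω)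
    [MeasureTheory.IsProbabilityMeasure μ] (φ : Bool → X) (ψ : Bool → Y)
    (π : Ω → CommProtocol X Y V) (S : Bool → Bool → Set V) {ε : ℝ} (hε0 : 0 ≤ ε) (hε : ε < 1 / 2)
    (hrow : ∀ α, Disjoint (S α false) (S α true)) (hcol : ∀ β, Disjoint (S false β) (S true β))
    (hS : ∀ α β, μ {ω | (π ω).output (φ α) (ψ β) ∉ S α β} ≤ ENNReal.ofReal ε) :
    ∃ ω α β, 0 < (π ω).bits (φ α) (ψ β) := by
  let bad : Bool → Bool → Set Ω := fun α β => {ω | (π ω).output (φ α) (ψ β) ∉ S α β}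
  obtain ⟨ω, hω⟩ := exists_sum_indicator_le μ (fun p : Bool × Bool => bad p.1 p.2) hε0
    fun p => hS p.1 p.2
  by_contra! hbits
  have h0 := hbits ω true true
  have hpair : ∀ E E' : Set Ω, (ω ∈ E ∨ ω ∈ E') →
      1 ≤ E.indicator (fun _ => (1 : ℝ)) ω + E'.indicator (fun _ => 1) ω := by
    intro E E' h
    by_cases hE : ω ∈ E <;> by_cases hE' : ω ∈ E' <;> simp_all
  simp only [Fintype.sum_prod_type, Fintype.sum_bool, Fintype.card_prod, Fintype.card_bool] at hω
  push_cast at hω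
  cases hπ : π ω with
  | aliceOutput out =>
    have hrow_bad : ∀ α, ω ∈ bad α true ∨ ω ∈ bad α false := fun α => by
      simp only [bad, Set.mem_ofPred_eq, hπ, CommProtocol.output]
      exact not_and_or.1 fun h => Set.disjoint_left.1 (hrow α) h.2 h.1
    linarith [hpair _ _ (hrow_bad true), hpair _ _ (hrow_bad false)]
  | bobOutput out =>
    have hcol_bad : ∀ β, ω ∈ bad true β ∨ ω ∈ bad false β := fun β => by
      simp only [bad, Set.mem_ofPred_eq, hπ, CommProtocol.output]
      exact not_and_or.1 fun h => Set.disjoint_left.1 (hcol β) h.2 h.1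
    linarith [hpair _ _ (hcol_bad true), hpair _ _ (hcol_bad false)]
  | aliceSend bit next => simp [hπ, CommProtocol.bits] at h0
  | bobSend bit next => simp [hπ, CommProtocol.bits] at h0

/-! ### Square-root Lasso with a single nonzero row -/

section SqrtLasso

/-- The `0/1` matrix whose row `i₀` is the indicator of `x` and whose other rows vanish. -/
noncomputable def rowMatrix {n d : ℕ} (i₀ : Fin n) (x : Fin d → Bool) :
    Matrix (Fin n) (Fin d) ℝ :=
  fun i j => if i = i₀ ∧ x j then 1 else 0

theorem isZeroOneMatrix_rowMatrix {n d : ℕ} (i₀ : Fin n) (x : Fin d → Bool) :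
    IsZeroOneMatrix (rowMatrix i₀ x) := fun i j => by
  unfold rowMatrix
  split_ifs <;> simp

variable {n d : ℕ} {i₀ : Fin n} {x y : Fin d → Bool} {lam : ℝ}

/-- Only the row `i₀` matters for the objective with target vector `Pi.single i₀ 1`. -/
theorem sqrtLassoCost_rowMatrix (i₀ : Fin n) (x y : Fin d → Bool) (lam : ℝ) (z : Fin d → ℝ) :
    sqrtLassoCost (rowMatrix i₀ x + rowMatrix i₀ y) (Pi.single i₀ 1) lam z =
      |∑ j, ((if x j then 1 else 0) + if y j then 1 else 0) * z j - 1| + lam * ∑ j, |z j| := by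
  have h : (rowMatrix i₀ x + rowMatrix i₀ y).mulVec z - Pi.single i₀ 1 =
      Pi.single i₀ (∑ j, ((if x j then 1 else 0) + if y j then 1 else 0) * z j - 1) := by
    ext i
    by_cases hi : i = i₀
    · subst hi
      simp [Matrix.mulVec, dotProduct, rowMatrix]
    · simp [Matrix.mulVec, dotProduct, rowMatrix, hi]
  rw [sqrtLassoCost, h, ← Real.norm_eq_abs]
  exact congrArg (· + _) (PiLp.norm_single 2 (fun _ => ℝ) i₀ _)

/-- A lower bound for the optimum when the entries of the row are at most `k`. The case `k = 0`,
`a = 1` is the empty row. -/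
theorem le_sqrtLassoOpt_rowMatrix {k : ℝ} (hlam : 0 < lam) {a : ℝ} (ha : 0 ≤ a) (ha1 : a ≤ 1)
    (hk : ∀ j, ((if x j then 1 else 0) + if y j then 1 else 0 : ℝ) ≤ k) (hak : a * k ≤ lam) :
    a ≤ sqrtLassoOpt (rowMatrix i₀ x + rowMatrix i₀ y) (Pi.single i₀ 1) lam := by
  obtain ⟨z, hz⟩ := (sqrtLassoOpt_isLeast (rowMatrix i₀ x + rowMatrix i₀ y)
    (Pi.single i₀ 1) hlam).1
  rw [← hz, sqrtLassoCost_rowMatrix]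
  set w : Fin d → ℝ := fun j => (if x j then 1 else 0) + if y j then 1 else 0
  have hw : ∀ j, 0 ≤ w j := fun j => by
    simp only [w]
    split_ifs <;> norm_num
  have h1 : ∑ j, w j * z j ≤ k * ∑ j, |z j| := by
    rw [mul_sum]
    refine sum_le_sum fun j _ => ?_
    exact (mul_le_mul_of_nonneg_left (le_abs_self _) (hw j)).trans
      (mul_le_mul_of_nonneg_right (hk j) (abs_nonneg _))
  have h2 : a * ∑ j, w j * z j ≤ lam * ∑ j, |z j| := by
    calc a * ∑ j, w j * z j ≤ a * (k * ∑ j, |z j|) := mul_le_mul_of_nonneg_left h1 ha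
      _ = a * k * ∑ j, |z j| := by ring
      _ ≤ _ := mul_le_mul_of_nonneg_right hak (sum_nonneg fun _ _ => abs_nonneg _)
  have h3 : a * (1 - ∑ j, w j * z j) ≤ |∑ j, w j * z j - 1| := by
    rw [abs_sub_comm]
    calc _ ≤ a * |1 - ∑ j, w j * z j| := mul_le_mul_of_nonneg_left (le_abs_self _) ha
      _ ≤ _ := mul_le_of_le_one_left (abs_nonneg _) ha1
  linarith

/-- An upper bound for the optimum, attained by fitting with the column `j` alone. -/
theorem sqrtLassoOpt_rowMatrix_le (hlam : 0 < lam) {k : ℝ} (hk : 0 < k) (j : Fin d)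
    (hj : ((if x j then 1 else 0) + if y j then 1 else 0 : ℝ) = k) :
    sqrtLassoOpt (rowMatrix i₀ x + rowMatrix i₀ y) (Pi.single i₀ 1) lam ≤ lam / k := by
  refine ((sqrtLassoOpt_isLeast _ _ hlam).2 ⟨Pi.single j k⁻¹, rfl⟩).trans (le_of_eq ?_)
  have h1 : ∑ l, |(Pi.single j k⁻¹ : Fin d → ℝ) l| = k⁻¹ := by
    rw [sum_eq_single j (fun l _ hl => by simp [hl]) (by simp)]
    simp [abs_of_pos hk]
  have h2 : ∑ l, ((if x l then 1 else 0) + if y l then 1 else 0 : ℝ) *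
      (Pi.single j k⁻¹ : Fin d → ℝ) l = 1 := by
    rw [sum_eq_single j (fun l _ hl => by simp [hl]) (by simp), hj, Pi.single_eq_same,
      mul_inv_cancel₀ hk.ne']
  rw [sqrtLassoCost_rowMatrix, h1, h2]
  simp [div_eq_mul_inv]

theorem le_sqrtLassoOpt_of_disjoint (hlam : 0 < lam) (hlam1 : lam ≤ 1)
    (h : ∀ j, ¬ (x j ∧ y j)) :
    lam ≤ sqrtLassoOpt (rowMatrix i₀ x + rowMatrix i₀ y) (Pi.single i₀ 1) lam := by
  refine le_sqrtLassoOpt_rowMatrix (k := 1) hlam hlam.le hlam1 (fun j => ?_) (by linarith)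
  have := h j
  by_cases hx : x j <;> by_cases hy : y j <;> simp_all

theorem sqrtLassoOpt_le_of_intersecting (hlam : 0 < lam) (h : ∃ j, x j ∧ y j) :
    sqrtLassoOpt (rowMatrix i₀ x + rowMatrix i₀ y) (Pi.single i₀ 1) lam ≤ lam / 2 := by
  obtain ⟨j, hx, hy⟩ := h
  exact sqrtLassoOpt_rowMatrix_le hlam two_pos j (by rw [if_pos hx, if_pos hy]; norm_num)

end SqrtLasso

/-- The sets of approximate values of two well separated optima are disjoint. -/
theorem disjoint_isApproxValue {c u v : ℝ} (h : (1 + c) * u < (1 - c) * v) :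
    Disjoint {w | IsApproxValue c u w} {w | IsApproxValue c v w} := by
  rw [Set.disjoint_left]
  rintro w ⟨-, h1⟩ ⟨h2, -⟩
  linarith

theorem lt_of_lt_two_mul_sqrt_two_div_three {lam : ℝ} (h : lam < 2 * Real.sqrt 2 / 3) :
    lam < 189 / 200 := by
  have : Real.sqrt 2 < 1.4175 := by
    rw [Real.sqrt_lt' (by norm_num)]
    norm_num
  linarith

/-! ### The reduction -/

/-- Any correct protocol exchanges at least one bit, because the three possible optimal values for
a single column tell `x + y` for the players' bits `x` and `y`. -/
theorem ApproximatesSqrtLasso.exists_pos_bits {Ω : Type} [MeasurableSpace Ω]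
    {μ : MeasureTheory.Measure Ω} [MeasureTheory.IsProbabilityMeasure μ] {n d : ℕ} (i₀ : Fin n)
    (hd : 0 < d)
    {π : Ω → CommProtocol (Matrix (Fin n) (Fin d) ℝ) (Matrix (Fin n) (Fin d) ℝ) ℝ}
    {lam c ε : ℝ} (hε0 : 0 < ε) (hε : ε < 1 / 2) (hc0 : 0 < c) (hc : c ≤ 1 / 50) (hlam : 0 < lam)
    (hlam1 : lam < 189 / 200) (hπ : ApproximatesSqrtLasso μ π (Pi.single i₀ 1) lam c ε) :
    ∃ (ω : Ω) (M₁ M₂ : Matrix (Fin n) (Fin d) ℝ),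
      IsZeroOneMatrix M₁ ∧ IsZeroOneMatrix M₂ ∧ 0 < (π ω).bits M₁ M₂ := by
  let j₀ : Fin d := ⟨0, hd⟩
  let col : Bool → Fin d → Bool := fun β => Function.update (fun _ => false) j₀ β
  let φ : Bool → Matrix (Fin n) (Fin d) ℝ := fun β => rowMatrix i₀ (col β)
  have hcol : ∀ β, col β j₀ = β := fun β => Function.update_self ..
  let opt : Bool → Bool → ℝ := fun α β => sqrtLassoOpt (φ α + φ β) (Pi.single i₀ 1) lam
  have h00 : 1 ≤ opt false false := by
    refine le_sqrtLassoOpt_rowMatrix (k := 0) hlam zero_le_one le_rfl (fun j => ?_) (by linarith)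
    by_cases hj : j = j₀ <;> simp [col, hj]
  have hge : ∀ α β : Bool, ¬ (α ∧ β) → lam ≤ opt α β := fun α β h => by
    refine le_sqrtLassoOpt_of_disjoint hlam (by linarith) fun j => ?_
    by_cases hj : j = j₀
    · subst hj
      rwa [hcol, hcol]
    · simp [col, hj]
  have h01 : opt false true ≤ lam := by
    simpa using sqrtLassoOpt_rowMatrix_le (i₀ := i₀) (x := col false) (y := col true) hlam
      one_pos j₀ (by simp [hcol])
  have h10 : opt true false ≤ lam := by
    simpa using sqrtLassoOpt_rowMatrix_le (i₀ := i₀) (x := col true) (y := col false) hlam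
      one_pos j₀ (by simp [hcol])
  have h11 : opt true true ≤ lam / 2 :=
    sqrtLassoOpt_le_of_intersecting hlam ⟨j₀, by simp [hcol]⟩
  have hsep1 : ∀ u, u ≤ lam → (1 + c) * u < (1 - c) * opt false false := fun u hu => by
    nlinarith
  have hsep2 : ∀ u, lam ≤ u → (1 + c) * opt true true < (1 - c) * u := fun u hu => by
    nlinarith
  obtain ⟨ω, α, β, h⟩ := _root_.exists_pos_bits μ φ φ π
    (fun α β => {w | IsApproxValue c (opt α β) w}) hε0.le hε
    (by
      rintro (_ | _)
      · exact (disjoint_isApproxValue (hsep1 _ h01)).symm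
      · exact (disjoint_isApproxValue (hsep2 _ (hge true false (by simp)))).symm)
    (by
      rintro (_ | _)
      · exact (disjoint_isApproxValue (hsep1 _ h10)).symm
      · exact (disjoint_isApproxValue (hsep2 _ (hge false true (by simp)))).symm)
    (fun α β => hπ _ _ (isZeroOneMatrix_rowMatrix _ _) (isZeroOneMatrix_rowMatrix _ _))
  exact ⟨ω, φ α, φ β, isZeroOneMatrix_rowMatrix _ _, isZeroOneMatrix_rowMatrix _ _, h⟩

/-- Reduction from set disjointness: an approximation to the optimum decides whether the rows of
the two players meet. -/
theorem ApproximatesSqrtLasso.exists_lt_bits {Ω : Type} [MeasurableSpace Ω]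
    {μ : MeasureTheory.Measure Ω} [MeasureTheory.IsProbabilityMeasure μ] {n d : ℕ} (i₀ : Fin n)
    {π : Ω → CommProtocol (Matrix (Fin n) (Fin d) ℝ) (Matrix (Fin n) (Fin d) ℝ) ℝ}
    {lam c ε t : ℝ} (hε0 : 0 < ε) (ht : 0 < t) (htε : 1 - 2 * ε = 32 * t) (hc0 : 0 < c)
    (hc : c ≤ 1 / 50) (hlam : 0 < lam) (hlam1 : lam ≤ 1)
    (hπ : ApproximatesSqrtLasso μ π (Pi.single i₀ 1) lam c ε) {C : ℕ}
    (hC : (2 : ℝ) ^ C < d * t ^ 2 * Real.exp (d * (t ^ 2 / 2))) :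
    ∃ (ω : Ω) (M₁ M₂ : Matrix (Fin n) (Fin d) ℝ),
      IsZeroOneMatrix M₁ ∧ IsZeroOneMatrix M₂ ∧ C < (π ω).bits M₁ M₂ := by
  obtain ⟨ω, x, y, h⟩ := exists_lt_bits_of_disjointness (ι := Fin d) μ (rowMatrix i₀)
    (rowMatrix i₀) π (Set.Ioi ((1 + c) * (lam / 2))) hε0.le ht htε
    (fun x y hxy => by
      refine (MeasureTheory.measure_mono ?_).trans
        (hπ _ _ (isZeroOneMatrix_rowMatrix i₀ x) (isZeroOneMatrix_rowMatrix i₀ y))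
      intro ω hω happ
      have h1 := le_sqrtLassoOpt_of_disjoint (i₀ := i₀) hlam hlam1 hxy
      refine hω ?_
      refine lt_of_lt_of_le ?_ happ.1
      nlinarith)
    (fun x y hxy => by
      refine (MeasureTheory.measure_mono ?_).trans
        (hπ _ _ (isZeroOneMatrix_rowMatrix i₀ x) (isZeroOneMatrix_rowMatrix i₀ y))
      intro ω hω happ
      have h1 := sqrtLassoOpt_le_of_intersecting (i₀ := i₀) hlam hxy
      refine absurd (happ.2.trans ?_) (not_le.2 hω)
      exact mul_le_mul_of_nonneg_left h1 (by linarith))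
    (C := C) (by simpa using hC)
  exact ⟨ω, _, _, isZeroOneMatrix_rowMatrix _ _, isZeroOneMatrix_rowMatrix _ _, h⟩

/-- The constant `κ` in the `Ω(d)` bound depends only on the error probability `ε`; the cost is the
worst case over inputs and coins. -/
theorem mainTheorem8 :
    ∃ c₀ : ℝ, 0 < c₀ ∧ ∀ ε : ℝ, 0 < ε → ε < 1 / 2 → ∃ κ : ℝ, 0 < κ ∧
      ∀ c : ℝ, 0 < c → c ≤ c₀ →
      ∀ lam : ℝ, 0 < lam → lam < 2 * Real.sqrt 2 / 3 →
      ∀ n : ℕ, 1 ≤ n → ∃ b : Fin n → ℝ, ∀ d : ℕ,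
      ∀ (Ω : Type) [MeasurableSpace Ω] (μ : MeasureTheory.Measure Ω)
        [MeasureTheory.IsProbabilityMeasure μ]
        (π : Ω → CommProtocol (Matrix (Fin n) (Fin d) ℝ) (Matrix (Fin n) (Fin d) ℝ) ℝ),
        ApproximatesSqrtLasso μ π b lam c ε →
        ∃ (ω : Ω) (M₁ M₂ : Matrix (Fin n) (Fin d) ℝ),
          IsZeroOneMatrix M₁ ∧ IsZeroOneMatrix M₂ ∧
          κ * (d : ℝ) ≤ ((π ω).bits M₁ M₂ : ℝ) := by
  refine ⟨1 / 50, by norm_num, fun ε hε0 hε => ?_⟩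
  -- With this `t` the loss `16 * t` in the rectangle bound is half of the advantage `1 - 2 * ε`.
  obtain ⟨t, ht, htε⟩ : ∃ t : ℝ, 0 < t ∧ 1 - 2 * ε = 32 * t :=
    ⟨(1 - 2 * ε) / 32, by linarith, by ring⟩
  refine ⟨t ^ 2 / 2, by positivity, fun c hc0 hc lam hlam hlam2 n hn => ?_⟩
  have hlam1 := lt_of_lt_two_mul_sqrt_two_div_three hlam2
  let i₀ : Fin n := ⟨0, hn⟩
  refine ⟨Pi.single i₀ 1, fun d Ω _ μ _ π hπ => ?_⟩
  rcases le_or_gt (t ^ 2 / 2 * d) 1 with hsmall | hlarge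
  · -- For small `d` the bound asks for a single bit, or for none if `d = 0`.
    rcases Nat.eq_zero_or_pos d with rfl | hd
    · obtain ⟨ω⟩ : Nonempty Ω := MeasureTheory.nonempty_of_isProbabilityMeasure μ
      exact ⟨ω, 0, 0, fun _ _ => Or.inl rfl, fun _ _ => Or.inl rfl, by simp⟩
    · obtain ⟨ω, M₁, M₂, h₁, h₂, h⟩ := hπ.exists_pos_bits i₀ hd hε0 hε hc0 hc hlam hlam1
      exact ⟨ω, M₁, M₂, h₁, h₂, hsmall.trans (by exact_mod_cast h)⟩
  · obtain ⟨ω, M₁, M₂, h₁, h₂, h⟩ := hπ.exists_lt_bits i₀ hε0 ht htε hc0 hc hlam (by linarith)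
      (C := ⌊t ^ 2 / 2 * d⌋₊) (by
        have hfl : (⌊t ^ 2 / 2 * d⌋₊ : ℝ) ≤ t ^ 2 / 2 * d := Nat.floor_le (by positivity)
        have h2 : (2 : ℝ) ≤ Real.exp 1 := by linarith [Real.add_one_le_exp (1 : ℝ)]
        calc (2 : ℝ) ^ ⌊t ^ 2 / 2 * d⌋₊ ≤ Real.exp 1 ^ ⌊t ^ 2 / 2 * d⌋₊ := by gcongr
          _ = Real.exp ⌊t ^ 2 / 2 * d⌋₊ := by rw [← Real.exp_nat_mul, mul_one]
          _ ≤ Real.exp (d * (t ^ 2 / 2)) := Real.exp_le_exp.2 (by linarith)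
          _ < d * t ^ 2 * Real.exp (d * (t ^ 2 / 2)) :=
            lt_mul_of_one_lt_left (Real.exp_pos _) (by linarith))
    exact ⟨ω, M₁, M₂, h₁, h₂, (Nat.lt_of_floor_lt h).le⟩
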